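/- Let $\mathbb{O}=\mathbb{H}\oplus\mathbb{H}$ be the octonions with the product $(a,b)(c,d)=(ac-db^{*},\,a^{*}d+cb)$, the conjugation $\overline{(a,b)}=(a^{*},-b)$ and the standard Euclidean inner product, and write $\mathbb{H}=\mathbb{H}\times\{0\}\subset\mathbb{O}$. A four-dimensional real subspace $C\subset\mathbb{O}$ is called $\mathbb{H}$-Lagrangian if there is a four-dimensional real subspace $L\subset\operatorname{Im}\mathbb{O}$ such that $Cu\perp C$ for every unit vector $u\in L$. Let $Spin(7)$ be the group of all linear isometries $\phi$ of $\mathbb{O}$ for which there is $\theta\in SO(\mathbb{O})$ with $\phi(vx)=\phi(v)\theta(x)$ for all $v,x\in\mathbb{O}$. Let $\Theta$ be the Cayley four-form $\Theta(x,y,z,w)=\langle x,\,y\times z\times w\rangle$ on $\mathbb{O}$, where $y\times z\times w=\tfrac12\bigl(y(\bar z w)-w(\bar z y)\bigr)$. A four-dimensional subspace $C$ is calibrated by $\Theta$ if $\Theta$ is a calibration, i.e. $\Theta(v_1,\dots,v_4)\le 1$ for all orthonormal $v_1,\dots,v_4\in\mathbb{O}$, and $\Theta|_C$ is the volume form of $C$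 for one of the two orientations of $C$. The $\mathbb{H}$-Lagrangian subspaces of $\mathbb{O}$ are exactly the Cayley subspaces in the sense of Harvey and Lawson, under both descriptions of the latter. That is, for every four-dimensional real subspace $C\subset\mathbb{O}$: 1. $C$ is $\mathbb{H}$-Lagrangian if and only if $C=\phi(\mathbb{H})$ for some $\phi\in Spin(7)$; 2. $C$ is $\mathbb{H}$-Lagrangian if and only if $C$ is calibrated by $\Theta$. -/

import Mathlib

open scoped Quaternion RealInnerProductSpace

/-- The octonions `𝕆 = ℍ ⊕ ℍ` as a real vector space, with the orthogonal direct sum inner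
product (so `‖(a, b)‖² = ‖a‖² + ‖b‖²`). -/
abbrev Octonion : Type := WithLp 2 (ℍ[ℝ] × ℍ[ℝ])

namespace Octonion

/-- The Cayley–Dickson product `(a, b) (c, d) = (a c - d b*, a* d + c b)`. -/
noncomputable instance : Mul Octonion where
  mul x y := WithLp.toLp 2
    (x.fst * y.fst - y.snd * star x.snd, star x.fst * y.snd + y.fst * x.snd)

/-- The Cayley–Dickson conjugation `(a, b)* = (a*, -b)`. -/
noncomputable def conj (x : Octonion) : Octonion := WithLp.toLp 2 (star x.fst, -x.snd)

theorem mul_fst (x y : Octonion) :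
    (x * y).fst = x.fst * y.fst - y.snd * star x.snd := rfl

theorem mul_snd (x y : Octonion) :
    (x * y).snd = star x.fst * y.snd + y.fst * x.snd := rfl

theorem conj_fst (x : Octonion) : (conj x).fst = star x.fst := rfl

theorem conj_snd (x : Octonion) : (conj x).snd = -x.snd := rfl

@[ext]
theorem ext {x y : Octonion} (h₁ : x.fst = y.fst) (h₂ : x.snd = y.snd) : x = y :=
  WithLp.ofLp_injective 2 (Prod.ext h₁ h₂)

theorem add_mul' (x y z : Octonion) : (x + y) * z = x * z + y * z := by
  ext1
  · simp only [mul_fst, WithLp.add_fst, WithLp.add_snd, star_add]; noncomm_ring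
  · simp only [mul_snd, WithLp.add_fst, WithLp.add_snd, star_add]; noncomm_ring

theorem mul_add' (x y z : Octonion) : x * (y + z) = x * y + x * z := by
  ext1
  · simp only [mul_fst, WithLp.add_fst, WithLp.add_snd]; noncomm_ring
  · simp only [mul_snd, WithLp.add_fst, WithLp.add_snd]; noncomm_ring

theorem smul_mul' (r : ℝ) (x y : Octonion) : (r • x) * y = r • (x * y) := by
  ext1
  · simp [mul_fst, smul_sub]
  · simp [mul_snd, smul_add]

theorem mul_smul' (r : ℝ) (x y : Octonion) : x * (r • y) = r • (x * y) := by
  ext1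
  · simp [mul_fst, smul_sub]
  · simp [mul_snd, smul_add]

theorem conj_add (x y : Octonion) : conj (x + y) = conj x + conj y := by
  ext1
  · simp [conj_fst]
  · simp [conj_snd, add_comm]

theorem conj_smul (r : ℝ) (x : Octonion) : conj (r • x) = r • conj x := by
  ext1
  · simp [conj_fst]
  · simp [conj_snd]

/-- The imaginary octonions. -/
def imaginary : Submodule ℝ Octonion where
  carrier := {x | x.fst.re = 0}
  add_mem' := by
    intro x y hx hy
    simp only [Set.mem_ofPred_eq] at hx hy ⊢
    simp [hx, hy]
  zero_mem' := by simp
  smul_mem' := by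
    intro r x hx
    simp only [Set.mem_ofPred_eq] at hx ⊢
    simp [hx]

/-- The subspace `ℍ = ℍ × {0}` of `𝕆`. -/
def quaternions : Submodule ℝ Octonion where
  carrier := {x | x.snd = 0}
  add_mem' := by
    intro x y hx hy
    simp only [Set.mem_ofPred_eq] at hx hy ⊢
    simp [hx, hy]
  zero_mem' := by simp
  smul_mem' := by
    intro r x hx
    simp only [Set.mem_ofPred_eq] at hx ⊢
    simp [hx]

/-- `J_u y = y u`, right multiplication by `u`. -/
noncomputable def J (u : Octonion) : Octonion →ₗ[ℝ] Octonion where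
  toFun y := y * u
  map_add' x y := add_mul' x y u
  map_smul' r x := smul_mul' r x u

/-- A four-dimensional real subspace `C` of `𝕆` is `ℍ`-Lagrangian if `J_u C ⟂ C` for all unit
vectors `u` in some four-dimensional real subspace `L` of `Im 𝕆`. -/
def IsHLagrangian (C : Submodule ℝ Octonion) : Prop :=
  Module.finrank ℝ C = 4 ∧
    ∃ L : Submodule ℝ Octonion, L ≤ imaginary ∧ Module.finrank ℝ L = 4 ∧
      ∀ u ∈ L, ‖u‖ = 1 → C.map (J u) ⟂ C

/-- `Spin(7) ⊂ O(8)`: the group of those linear isometries `φ` of `𝕆` that are twisted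
isomorphisms, i.e. `φ (v x) = φ v * θ x` for some `θ ∈ SO(𝕆)`. -/
noncomputable def spin7 : Subgroup (Octonion ≃ₗᵢ[ℝ] Octonion) where
  carrier := {φ | ∃ θ : Octonion ≃ₗᵢ[ℝ] Octonion,
    LinearMap.det (θ.toLinearEquiv : Octonion →ₗ[ℝ] Octonion) = 1 ∧
      ∀ v x : Octonion, φ (v * x) = φ v * θ x}
  one_mem' := ⟨1, LinearMap.det_id, fun _ _ => rfl⟩
  mul_mem' := by
    rintro φ ψ ⟨θ, hθ, h⟩ ⟨η, hη, k⟩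
    refine ⟨θ * η, ?_, fun v x => ?_⟩
    · have e : (((θ * η : Octonion ≃ₗᵢ[ℝ] Octonion).toLinearEquiv :
          Octonion ≃ₗ[ℝ] Octonion) : Octonion →ₗ[ℝ] Octonion) =
          (θ.toLinearEquiv : Octonion →ₗ[ℝ] Octonion) ∘ₗ
            (η.toLinearEquiv : Octonion →ₗ[ℝ] Octonion) := rfl
      rw [e, LinearMap.det_comp, hθ, hη, one_mul]
    · change φ (ψ (v * x)) = φ (ψ v) * θ (η x)
      rw [k, h]
  inv_mem' := by
    rintro φ ⟨θ, hθ, h⟩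
    refine ⟨θ⁻¹, ?_, fun v x => ?_⟩
    · have e := LinearEquiv.det_symm_mul_det θ.toLinearEquiv
      rw [hθ, mul_one] at e
      exact e
    · change φ.symm (v * x) = φ.symm v * θ.symm x
      rw [LinearIsometryEquiv.symm_apply_eq, h, LinearIsometryEquiv.apply_symm_apply,
        LinearIsometryEquiv.apply_symm_apply]

/-- The images of `ℍ ⊂ 𝕆` under `Spin(7)`. -/
def IsSpin7Translate (C : Submodule ℝ Octonion) : Prop :=
  ∃ φ ∈ spin7, C = quaternions.map (φ.toLinearEquiv : Octonion →ₗ[ℝ] Octonion)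

/-- The triple cross product `x × y × z = ½ (x (y* z) - z (y* x))`. -/
noncomputable def tripleCross (x y z : Octonion) : Octonion :=
  (1 / 2 : ℝ) • (x * (conj y * z) - z * (conj y * x))

theorem inner_eq (x y : Octonion) :
    ⟪x, y⟫ = x.fst.re * y.fst.re + x.fst.imI * y.fst.imI + x.fst.imJ * y.fst.imJ
      + x.fst.imK * y.fst.imK + x.snd.re * y.snd.re + x.snd.imI * y.snd.imI
      + x.snd.imJ * y.snd.imJ + x.snd.imK * y.snd.imK := by
  rw [WithLp.prod_inner_apply, Quaternion.inner_def, Quaternion.inner_def]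
  simp [Quaternion.re_mul]
  ring

theorem mul_conj_mul (x z : Octonion) : x * (conj x * z) = z * (conj x * x) := by
  have hcoe : ∀ (r : ℝ) (q : ℍ[ℝ]), (r : ℍ[ℝ]) * q = q * (r : ℍ[ℝ]) := fun r q =>
    Quaternion.coe_commutes r q
  have h1 := Quaternion.self_mul_star x.fst
  have h2 := Quaternion.star_mul_self x.fst
  have h3 := Quaternion.self_mul_star x.snd
  have h4 := Quaternion.star_mul_self x.snd
  ext1
  · simp only [mul_fst, mul_snd, conj_fst, conj_snd, star_neg, star_star]
    simp only [mul_add, add_mul, mul_neg, neg_mul, sub_neg_eq_add, mul_assoc, h2, h3]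
    simp only [← mul_assoc, h1, hcoe]
    abel
  · simp only [mul_fst, mul_snd, conj_fst, conj_snd, star_neg, star_star]
    simp only [mul_add, add_mul, mul_neg, sub_neg_eq_add, mul_assoc, h2, h3, h4]
    simp only [← mul_assoc, h2, hcoe]
    abel

theorem tripleCross_self (x y z : Octonion) :
    tripleCross x y x = 0 ∧ tripleCross x x z = 0 ∧ tripleCross z x x = 0 := by
  refine ⟨by simp [tripleCross], ?_, ?_⟩ <;> simp [tripleCross, mul_conj_mul]

theorem inner_tripleCross_self (x y z : Octonion) :
    ⟪x, tripleCross x y z⟫ = 0 ∧ ⟪x, tripleCross y x z⟫ = 0 ∧ ⟪x, tripleCross y z x⟫ = 0 := by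
  refine ⟨?_, ?_, ?_⟩ <;>
  · rw [inner_eq]
    simp [tripleCross, mul_fst, mul_snd, conj_fst, conj_snd, Quaternion.re_mul,
      Quaternion.imI_mul, Quaternion.imJ_mul, Quaternion.imK_mul]
    ring

theorem cayleyForm_aux_add (v : Fin 4 → Octonion) (i : Fin 4) (x y : Octonion) :
    let f : (Fin 4 → Octonion) → ℝ := fun w => ⟪w 0, tripleCross (w 1) (w 2) (w 3)⟫
    f (Function.update v i (x + y)) = f (Function.update v i x) + f (Function.update v i y) := by
  have h01 : (0 : Fin 4) ≠ 1 := by decide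
  have h02 : (0 : Fin 4) ≠ 2 := by decide
  have h03 : (0 : Fin 4) ≠ 3 := by decide
  have h12 : (1 : Fin 4) ≠ 2 := by decide
  have h13 : (1 : Fin 4) ≠ 3 := by decide
  have h23 : (2 : Fin 4) ≠ 3 := by decide
  have hi : i = 0 ∨ i = 1 ∨ i = 2 ∨ i = 3 := by omega
  rcases hi with rfl | rfl | rfl | rfl <;>
  · simp only [Function.update_self, Function.update_of_ne, h01, h02, h03, h12, h13, h23, h01.symm,
      h02.symm, h03.symm, h12.symm, h13.symm, h23.symm, ne_eq, not_false_eq_true, tripleCross,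
      conj_add, add_mul', mul_add', inner_add_left, inner_add_right, inner_sub_right,
      inner_smul_right]
    try ring

theorem cayleyForm_aux_smul (v : Fin 4 → Octonion) (i : Fin 4) (r : ℝ) (x : Octonion) :
    let f : (Fin 4 → Octonion) → ℝ := fun w => ⟪w 0, tripleCross (w 1) (w 2) (w 3)⟫
    f (Function.update v i (r • x)) = r • f (Function.update v i x) := by
  have h01 : (0 : Fin 4) ≠ 1 := by decide
  have h02 : (0 : Fin 4) ≠ 2 := by decide
  have h03 : (0 : Fin 4) ≠ 3 := by decide
  have h12 : (1 : Fin 4) ≠ 2 := by decide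
  have h13 : (1 : Fin 4) ≠ 3 := by decide
  have h23 : (2 : Fin 4) ≠ 3 := by decide
  have hi : i = 0 ∨ i = 1 ∨ i = 2 ∨ i = 3 := by omega
  rcases hi with rfl | rfl | rfl | rfl <;>
  · simp only [Function.update_self, Function.update_of_ne, h01, h02, h03, h12, h13, h23, h01.symm,
      h02.symm, h03.symm, h12.symm, h13.symm, h23.symm, ne_eq, not_false_eq_true, tripleCross,
      conj_smul, smul_mul', mul_smul', real_inner_smul_left, inner_sub_right,
      real_inner_smul_right, smul_eq_mul]
    try ring

/-- The Cayley four-form `Θ (x, y, z, w) = ⟨x, y × z × w⟩` on `𝕆`. -/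
noncomputable def cayleyForm : Octonion [⋀^Fin 4]→ₗ[ℝ] ℝ :=
  { MultilinearMap.mk' (fun v : Fin 4 → Octonion => ⟪v 0, tripleCross (v 1) (v 2) (v 3)⟫)
      cayleyForm_aux_add cayleyForm_aux_smul with
    map_eq_zero_of_eq' := by
      intro v i j h hij
      change ⟪v 0, tripleCross (v 1) (v 2) (v 3)⟫ = 0
      fin_cases i <;> fin_cases j <;>
      first
      | exact absurd rfl hij
      | (simp only [Fin.mk_zero, Fin.mk_one, Fin.reduceFinMk, Fin.isValue] at h
         simp only [h]
         simp only [(tripleCross_self _ _ 0).1, (tripleCross_self _ 0 _).2.1,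
           (tripleCross_self _ 0 _).2.2, (inner_tripleCross_self _ _ _).1,
           (inner_tripleCross_self _ _ _).2.1, (inner_tripleCross_self _ _ _).2.2,
           inner_zero_right]) }

theorem cayleyForm_apply (v : Fin 4 → Octonion) :
    cayleyForm v = ⟪v 0, tripleCross (v 1) (v 2) (v 3)⟫ := rfl

end Octonion

/-- A constant-coefficient `k`-form `Φ` on a Euclidean space (such a form is closed) is a volume
calibrating form if `Φ|_P ≤ dv_P` for every oriented `k`-plane `P`. -/
def IsCalibratingForm {E : Type*} [NormedAddCommGroup E] [InnerProductSpace ℝ E] {k : ℕ}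
    (Φ : E [⋀^Fin k]→ₗ[ℝ] ℝ) : Prop :=
  ∀ v : Fin k → E, Orthonormal ℝ v → Φ v ≤ 1

/-- A `k`-dimensional subspace `C` is calibrated by `Φ` if `Φ` is a volume calibrating form and
`Φ|_C = dv_C` for a suitable orientation of `C`. -/
def IsCalibratedBy {E : Type*} [NormedAddCommGroup E] [InnerProductSpace ℝ E] {k : ℕ}
    (Φ : E [⋀^Fin k]→ₗ[ℝ] ℝ) (C : Submodule ℝ E) : Prop :=
  IsCalibratingForm Φ ∧
    ∃ (_ : Fact (Module.finrank ℝ C = k)) (o : Orientation ℝ C (Fin k)),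
      Φ.compLinearMap C.subtype = o.volumeForm

/-!
For unit `u`, `⟪x u, y⟫ = ⟪u, x̄ y⟫`. Hence `C` is `ℍ`-Lagrangian iff the products `x̄ y` with
`x, y ∈ C` all lie in one four-plane `M` (then `1 ∈ M` and `L = Mᗮ`), and by counting dimensions
`x̄ C = M` for each nonzero `x ∈ C`, that is, `x M = C`. This in turn says that `C` is closed under
the triple cross product. For orthonormal `v₀, …, v₃` the vector `v₁ × v₂ × v₃` is a unit vector
orthogonal to `v₁, v₂, v₃`, so `|Θ (v₀, …, v₃)| = 1` iff it is `±v₀`; this gives the calibration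
criterion.

If `θ` is the twist of `φ ∈ Spin(7)`, then `θ (x̄ y) = conj (φ x) (φ y)`, so `φ` moves
`ℍ`-Lagrangian planes with product plane `M` to those with product plane `θ M`. Right multiplication
by an imaginary unit `u` lies in `Spin(7)`, and its twist acts on `Im 𝕆` as minus the reflection in
`uᗮ`. By Cartan–Dieudonné every isometry of `Im 𝕆` is therefore a twist up to sign, and one may
assume `M = ℍ`. Then `C` is `ℍ` or `ℍᗮ`: a vector `(a, b) ∈ C` with `a, b ≠ 0` would force `ℍ` to be
commutative.
-/

theorem exists_mem_ne_zero_of_finrank_ne_zero {K V : Type*} [DivisionRing K] [AddCommGroup V]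
    [Module K V] {S : Submodule K V} (h : Module.finrank K S ≠ 0) : ∃ x ∈ S, x ≠ 0 :=
  S.exists_mem_ne_zero_of_ne_bot fun hS => h (hS ▸ finrank_bot K V)

theorem exists_linearIsometryEquiv_map_eq {𝕜 E : Type*} [RCLike 𝕜] [NormedAddCommGroup E]
    [InnerProductSpace 𝕜 E] [FiniteDimensional 𝕜 E] {S T : Submodule 𝕜 E}
    (h : Module.finrank 𝕜 S = Module.finrank 𝕜 T) :
    ∃ ψ : E ≃ₗᵢ[𝕜] E, S.map (ψ.toLinearEquiv : E →ₗ[𝕜] E) = T := by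
  let e : S ≃ₗᵢ[𝕜] T :=
    (stdOrthonormalBasis 𝕜 S).equiv (stdOrthonormalBasis 𝕜 T) (finCongr h)
  let f : S →ₗᵢ[𝕜] E := T.subtypeₗᵢ.comp e.toLinearIsometry
  let ψ : E ≃ₗᵢ[𝕜] E := f.extend.toLinearIsometryEquiv rfl
  refine ⟨ψ, Submodule.eq_of_le_of_finrank_eq ?_ ?_⟩
  · rintro _ ⟨x, hx, rfl⟩
    change f.extend x ∈ T
    rw [f.extend_apply ⟨x, hx⟩]
    exact (e ⟨x, hx⟩).2
  · rw [ψ.toLinearEquiv.finrank_map_eq, h]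

section InnerProductSpace

variable {E : Type*} [NormedAddCommGroup E] [InnerProductSpace ℝ E]

theorem reflection_orthogonal_span_singleton_apply {u : E} (hu : ‖u‖ = 1) (x : E) :
    (ℝ ∙ u)ᗮ.reflection x = x - (2 * ⟪u, x⟫) • u := by
  rw [Submodule.reflection_orthogonal_apply, Submodule.reflection_singleton_apply, hu]
  simp only [RCLike.ofReal_one, one_pow, div_one]
  module

theorem coe_reflection_orthogonal_span_singleton {S : Submodule ℝ E} (v x : S) :
    ((ℝ ∙ v)ᗮ.reflection x : E) = (ℝ ∙ (v : E))ᗮ.reflection (x : E) := by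
  simp only [Submodule.reflection_orthogonal_apply, Submodule.reflection_singleton_apply]
  rfl

end InnerProductSpace

section Calibration

variable {E : Type*} [NormedAddCommGroup E] [InnerProductSpace ℝ E] {k : ℕ}

theorem exists_eq_volumeForm_of_abs_apply_eq_one [Fact (Module.finrank ℝ E = k)]
    {Φ : E [⋀^Fin k]→ₗ[ℝ] ℝ} (e : OrthonormalBasis (Fin k) ℝ E) (h : |Φ e| = 1) :
    ∃ o : Orientation ℝ E (Fin k), Φ = o.volumeForm := by
  have hΦ : Φ = Φ e • e.toBasis.det := by
    simpa only [e.coe_toBasis] using Φ.eq_smul_basis_det e.toBasis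
  have hvol := e.toBasis.orientation.volumeForm_robust e rfl
  rcases eq_or_eq_neg_of_abs_eq h with h | h
  · exact ⟨e.toBasis.orientation, by rw [hΦ, h, hvol, one_smul]⟩
  · exact ⟨-e.toBasis.orientation, by
      rw [hΦ, h, Orientation.volumeForm_neg_orientation, hvol]
      exact neg_one_smul ℝ e.toBasis.det⟩

theorem isCalibratedBy_iff_abs_apply_eq_one {Φ : E [⋀^Fin k]→ₗ[ℝ] ℝ} {C : Submodule ℝ E}
    (e : OrthonormalBasis (Fin k) ℝ C) :
    IsCalibratedBy Φ C ↔ IsCalibratingForm Φ ∧ |Φ fun i => (e i : E)| = 1 := by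
  refine and_congr_right fun _ => ⟨?_, fun h => ?_⟩
  · rintro ⟨_, o, ho⟩
    rw [← o.abs_volumeForm_apply_of_orthonormal e, ← ho]
    rfl
  · have : Fact (Module.finrank ℝ C = k) := ⟨by simp [Module.finrank_eq_card_basis e.toBasis]⟩
    exact ⟨this, exists_eq_volumeForm_of_abs_apply_eq_one e h⟩

end Calibration

namespace Octonion

/-! ### The algebra of octonions -/

noncomputable instance : One Octonion where
  one := WithLp.toLp 2 (1, 0)

theorem one_fst : (1 : Octonion).fst = 1 := rfl

theorem one_snd : (1 : Octonion).snd = 0 := rfl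

noncomputable scoped instance : NonAssocRing Octonion where
  __ := (inferInstance : AddCommGroup Octonion)
  left_distrib := mul_add'
  right_distrib := add_mul'
  zero_mul x := by simpa using smul_mul' 0 0 x
  mul_zero x := by simpa using mul_smul' 0 x 0
  one_mul x := by ext1 <;> simp [mul_fst, mul_snd, one_fst, one_snd]
  mul_one x := by ext1 <;> simp [mul_fst, mul_snd, one_fst, one_snd]

scoped instance : IsScalarTower ℝ Octonion Octonion where
  smul_assoc := smul_mul'

scoped instance : SMulCommClass ℝ Octonion Octonion where
  smul_comm r x y := (mul_smul' r x y).symm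

theorem inner_one_left (x : Octonion) : ⟪1, x⟫ = x.fst.re := by
  rw [inner_eq, one_fst, one_snd]
  simp

theorem norm_one : ‖(1 : Octonion)‖ = 1 := by
  rw [norm_eq_sqrt_real_inner, inner_one_left, one_fst]
  simp

theorem finrank_eq_eight : Module.finrank ℝ Octonion = 8 := by
  rw [(WithLp.linearEquiv 2 ℝ (ℍ[ℝ] × ℍ[ℝ])).finrank_eq, Module.finrank_prod,
    Quaternion.finrank_eq_four]

theorem mem_imaginary_iff_inner_one {x : Octonion} : x ∈ imaginary ↔ ⟪1, x⟫ = 0 := by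
  rw [inner_one_left]
  rfl

theorem conj_conj (x : Octonion) : conj (conj x) = x := by
  ext1 <;> simp [conj_fst, conj_snd]

theorem conj_mul (x y : Octonion) : conj (x * y) = conj y * conj x := by
  ext1
  · simp [conj_fst, conj_snd, mul_fst]
  · simp [conj_fst, conj_snd, mul_snd, add_comm]

theorem reflection_span_one (x : Octonion) : (ℝ ∙ (1 : Octonion)).reflection x = conj x := by
  rw [Submodule.reflection_singleton_apply, norm_one, inner_one_left, two_smul]
  ext1
  · ext <;> simp [conj_fst, one_fst]
  · ext <;> simp [conj_snd, one_snd]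

theorem norm_conj (x : Octonion) : ‖conj x‖ = ‖x‖ := by
  rw [← reflection_span_one, LinearIsometryEquiv.norm_map]

theorem conj_of_mem_imaginary {x : Octonion} (hx : x ∈ imaginary) : conj x = -x := by
  rw [← reflection_span_one, Submodule.reflection_singleton_apply,
    mem_imaginary_iff_inner_one.1 hx]
  simp

theorem conj_mul_self (x : Octonion) : conj x * x = ‖x‖ ^ 2 • (1 : Octonion) := by
  rw [WithLp.prod_norm_sq_eq_of_L2, sq, sq, ← Quaternion.normSq_eq_norm_mul_self,
    ← Quaternion.normSq_eq_norm_mul_self]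
  ext1
  · simp [mul_fst, conj_fst, conj_snd, one_fst, Quaternion.star_mul_self,
      Quaternion.self_mul_star, Algebra.smul_def]
  · simp [mul_snd, conj_fst, conj_snd, one_snd]

theorem mul_conj_mul_self (x y : Octonion) : x * (conj x * y) = ‖x‖ ^ 2 • y := by
  rw [mul_conj_mul, conj_mul_self, mul_smul_comm, mul_one]

theorem conj_mul_mul_self (x y : Octonion) : conj x * (x * y) = ‖x‖ ^ 2 • y := by
  simpa only [conj_conj, norm_conj] using mul_conj_mul_self (conj x) y

theorem mul_mul_conj_self (x y : Octonion) : (y * x) * conj x = ‖x‖ ^ 2 • y := by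
  have h := congrArg conj (mul_conj_mul_self x (conj y))
  rwa [conj_mul, conj_mul, conj_conj, conj_conj, conj_smul, conj_conj] at h

theorem conj_mul_add_conj_mul (x y : Octonion) :
    conj x * y + conj y * x = (2 * ⟪x, y⟫) • (1 : Octonion) := by
  have h := conj_mul_self (x + y)
  simp only [conj_add, add_mul, mul_add, norm_add_sq_real, conj_mul_self] at h
  linear_combination (norm := module) h

theorem mul_conj_mul_add (x y z : Octonion) :
    x * (conj y * z) + y * (conj x * z) = (2 * ⟪x, y⟫) • z := by
  have h := mul_conj_mul_self (x + y) z
  simp only [conj_add, add_mul, mul_add, norm_add_sq_real, mul_conj_mul_self] at h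
  linear_combination (norm := module) h

theorem mul_mul_conj_add (x y z : Octonion) :
    (z * x) * conj y + (z * y) * conj x = (2 * ⟪x, y⟫) • z := by
  have h := mul_mul_conj_self (x + y) z
  simp only [conj_add, add_mul, mul_add, norm_add_sq_real, mul_mul_conj_self] at h
  linear_combination (norm := module) h

theorem inner_mul_left (x u y : Octonion) : ⟪x * u, y⟫ = ⟪u, conj x * y⟫ := by
  simp only [inner_eq, mul_fst, mul_snd, conj_fst, conj_snd, star_neg, star_star,
    Quaternion.re_add, Quaternion.imI_add, Quaternion.imJ_add, Quaternion.imK_add,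
    Quaternion.re_sub, Quaternion.imI_sub, Quaternion.imJ_sub, Quaternion.imK_sub,
    Quaternion.re_neg, Quaternion.imI_neg, Quaternion.imJ_neg, Quaternion.imK_neg,
    Quaternion.re_mul, Quaternion.imI_mul, Quaternion.imJ_mul, Quaternion.imK_mul,
    Quaternion.re_star, Quaternion.imI_star, Quaternion.imJ_star, Quaternion.imK_star]
  ring

theorem norm_mul (x y : Octonion) : ‖x * y‖ = ‖x‖ * ‖y‖ := by
  refine (sq_eq_sq₀ (norm_nonneg _) (by positivity)).1 ?_
  rw [← real_inner_self_eq_norm_sq, inner_mul_left, conj_mul_mul_self, real_inner_smul_right,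
    real_inner_self_eq_norm_sq, mul_pow]

/-! ### The Cayley calibration -/

variable {C M N : Submodule ℝ Octonion}

theorem mulLeft_injective {x : Octonion} (hx : x ≠ 0) :
    Function.Injective (LinearMap.mulLeft ℝ x) := fun y z h => by
  have h' : conj x * (x * y) = conj x * (x * z) := congrArg (conj x * ·) h
  rw [conj_mul_mul_self, conj_mul_mul_self] at h'
  exact smul_right_injective _ (pow_ne_zero 2 (norm_ne_zero_iff.2 hx)) h'

theorem finrank_map_mulLeft {x : Octonion} (hx : x ≠ 0) (C : Submodule ℝ Octonion) :
    Module.finrank ℝ (C.map (LinearMap.mulLeft ℝ x)) = Module.finrank ℝ C :=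
  (C.equivMapOfInjective _ (mulLeft_injective hx)).finrank_eq.symm

theorem mul_mem_of_conj_mul_mem (hdim : Module.finrank ℝ M ≤ Module.finrank ℝ C)
    (h : ∀ x ∈ C, ∀ y ∈ C, conj x * y ∈ M) {x m : Octonion} (hx : x ∈ C) (hm : m ∈ M) :
    x * m ∈ C := by
  rcases eq_or_ne x 0 with rfl | hx₀
  · simp
  have hx₀' : conj x ≠ 0 := by rwa [← norm_ne_zero_iff, norm_conj, norm_ne_zero_iff]
  have hCM : C.map (LinearMap.mulLeft ℝ (conj x)) = M := by
    refine Submodule.eq_of_le_of_finrank_le ?_ (by rwa [finrank_map_mulLeft hx₀'])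
    rintro _ ⟨y, hy, rfl⟩
    exact h x hx y hy
  obtain ⟨y, hy, rfl⟩ := hCM.symm ▸ hm
  rw [LinearMap.mulLeft_apply, mul_conj_mul_self]
  exact C.smul_mem _ hy

theorem map_J_isOrtho_iff {u : Octonion} :
    C.map (J u) ⟂ C ↔ ∀ x ∈ C, ∀ y ∈ C, ⟪u, conj x * y⟫ = 0 := by
  simp only [Submodule.isOrtho_iff_inner_eq, Submodule.mem_map, forall_exists_index, and_imp,
    forall_apply_eq_imp_iff₂, ← inner_mul_left]
  rfl

theorem finrank_orthogonal_eq_four (hM : Module.finrank ℝ M = 4) : Module.finrank ℝ Mᗮ = 4 :=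
  Submodule.finrank_add_finrank_orthogonal' (by rw [hM, finrank_eq_eight])

theorem one_mem_of_conj_mul_mem {x : Octonion} (hx : x ≠ 0) (h : conj x * x ∈ M) : 1 ∈ M := by
  rw [conj_mul_self] at h
  exact (M.smul_mem_iff (pow_ne_zero 2 (norm_ne_zero_iff.2 hx))).1 h

theorem orthogonal_le_imaginary (h : 1 ∈ M) : Mᗮ ≤ imaginary := fun _ hx =>
  mem_imaginary_iff_inner_one.2 (Submodule.inner_right_of_mem_orthogonal h hx)

theorem isHLagrangian_iff_exists_conj_mul_mem :
    IsHLagrangian C ↔ Module.finrank ℝ C = 4 ∧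
      ∃ M : Submodule ℝ Octonion, Module.finrank ℝ M = 4 ∧
        ∀ x ∈ C, ∀ y ∈ C, conj x * y ∈ M := by
  refine and_congr_right fun hC => ⟨?_, ?_⟩
  · rintro ⟨L, -, hL, h⟩
    refine ⟨Lᗮ, finrank_orthogonal_eq_four hL, fun x hx y hy => ?_⟩
    refine (Submodule.mem_orthogonal _ _).2 fun u hu => ?_
    rcases eq_or_ne u 0 with rfl | hu₀
    · exact inner_zero_left _
    · have hunit := map_J_isOrtho_iff.1
        (h (‖u‖⁻¹ • u) (L.smul_mem _ hu) (norm_smul_inv_norm hu₀)) x hx y hy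
      rw [real_inner_smul_left] at hunit
      exact (mul_eq_zero.1 hunit).resolve_left (inv_ne_zero (norm_ne_zero_iff.2 hu₀))
  · rintro ⟨M, hM, h⟩
    obtain ⟨x, hx, hx₀⟩ := exists_mem_ne_zero_of_finrank_ne_zero (hC ▸ four_ne_zero)
    have hone : 1 ∈ M := one_mem_of_conj_mul_mem hx₀ (h x hx x hx)
    exact ⟨Mᗮ, orthogonal_le_imaginary hone, finrank_orthogonal_eq_four hM, fun u hu _ =>
      map_J_isOrtho_iff.2 fun x hx y hy =>
        Submodule.inner_left_of_mem_orthogonal (h x hx y hy) hu⟩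

theorem mul_conj_mul_eq_tripleCross_add (x y z : Octonion) :
    x * (conj y * z) = tripleCross x y z + ⟪x, y⟫ • z + ⟪y, z⟫ • x - ⟪x, z⟫ • y := by
  have hxy := mul_conj_mul_add x y z
  have hyz := mul_conj_mul_add y z x
  have hxz : y * (conj x * z) + y * (conj z * x) = (2 * ⟪x, z⟫) • y := by
    rw [← mul_add, conj_mul_add_conj_mul, mul_smul_comm, mul_one]
  rw [tripleCross]
  linear_combination (norm := module) (1 / 2 : ℝ) • hxy + (1 / 2 : ℝ) • hyz - (1 / 2 : ℝ) • hxz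

theorem isHLagrangian_iff_tripleCross_mem :
    IsHLagrangian C ↔ Module.finrank ℝ C = 4 ∧
      ∀ x ∈ C, ∀ y ∈ C, ∀ z ∈ C, tripleCross x y z ∈ C := by
  rw [isHLagrangian_iff_exists_conj_mul_mem]
  refine and_congr_right fun hC => ⟨?_, fun h => ?_⟩
  · rintro ⟨M, hM, h⟩ x hx y hy z hz
    have hmul {a b c : Octonion} (ha : a ∈ C) (hb : b ∈ C) (hc : c ∈ C) :
        a * (conj b * c) ∈ C :=
      mul_mem_of_conj_mul_mem (hM.trans hC.symm).le h ha (h b hb c hc)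
    exact C.smul_mem _ (C.sub_mem (hmul hx hy hz) (hmul hz hy hx))
  · obtain ⟨e, he, he₀⟩ := exists_mem_ne_zero_of_finrank_ne_zero (hC ▸ four_ne_zero)
    have he₀' : conj e ≠ 0 := by rwa [← norm_ne_zero_iff, norm_conj, norm_ne_zero_iff]
    refine ⟨C.map (LinearMap.mulLeft ℝ (conj e)), by rwa [finrank_map_mulLeft he₀'],
      fun x hx y hy => ?_⟩
    have hexy : e * (conj x * y) ∈ C := by
      rw [mul_conj_mul_eq_tripleCross_add]
      exact C.sub_mem (C.add_mem (C.add_mem (h e he x hx y hy) (C.smul_mem _ hy))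
        (C.smul_mem _ he)) (C.smul_mem _ hx)
    refine (Submodule.smul_mem_iff _ (pow_ne_zero 2 (norm_ne_zero_iff.2 he₀))).1 ?_
    rw [← conj_mul_mul_self]
    exact Submodule.mem_map_of_mem hexy

theorem norm_tripleCross_of_orthogonal {x y z : Octonion} (hxy : ⟪x, y⟫ = 0) (hyz : ⟪y, z⟫ = 0)
    (hxz : ⟪x, z⟫ = 0) : ‖tripleCross x y z‖ = ‖x‖ * ‖y‖ * ‖z‖ := by
  have h := mul_conj_mul_eq_tripleCross_add x y z
  rw [hxy, hyz, hxz, zero_smul, zero_smul, zero_smul, add_zero, add_zero, sub_zero] at h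
  rw [← h, norm_mul, norm_mul, norm_conj, mul_assoc]

section Orthonormal

variable {v : Fin 4 → Octonion}

theorem norm_tripleCross_of_orthonormal (hv : Orthonormal ℝ v) :
    ‖tripleCross (v 1) (v 2) (v 3)‖ = 1 := by
  rw [norm_tripleCross_of_orthogonal (hv.2 (by decide)) (hv.2 (by decide)) (hv.2 (by decide)),
    hv.1, hv.1, hv.1, one_mul, one_mul]

theorem isCalibratingForm_cayleyForm : IsCalibratingForm cayleyForm := fun v hv => by
  have h := real_inner_le_norm (v 0) (tripleCross (v 1) (v 2) (v 3))
  rwa [hv.1, norm_tripleCross_of_orthonormal hv, one_mul] at h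

theorem tripleCross_eq_smul_of_abs_cayleyForm_eq_one (hv : Orthonormal ℝ v)
    (h : |cayleyForm v| = 1) :
    tripleCross (v 1) (v 2) (v 3) = cayleyForm v • v 0 := by
  rw [cayleyForm_apply] at h ⊢
  have hc := norm_tripleCross_of_orthonormal hv
  rcases eq_or_eq_neg_of_abs_eq h with h | h
  · rw [h, one_smul, (inner_eq_one_iff_of_norm_eq_one (hv.1 0) hc).1 h]
  · rw [h, neg_one_smul, eq_comm, neg_eq_iff_eq_neg,
      (inner_eq_neg_one_iff_of_norm_eq_one (hv.1 0) hc).1 h]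

theorem cayleyForm_cons_eq_zero {w : Octonion} (hv : Orthonormal ℝ v)
    (h : |cayleyForm v| = 1) (hw : ∀ i, ⟪w, v i⟫ = 0) {j : Fin 3 → Fin 4}
    (hj : Function.Injective j) : cayleyForm (Matrix.vecCons w (v ∘ j)) = 0 := by
  obtain ⟨l, hl⟩ : ∃ l, l ∉ Set.range j := by
    by_contra! hsurj
    simpa using Fintype.card_le_of_surjective j hsurj
  let σ : Equiv.Perm (Fin 4) := Equiv.ofBijective (Fin.cons l j)
    (Finite.injective_iff_bijective.1 (Fin.cons_injective_iff.2 ⟨hl, hj⟩))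
  have hσ : |cayleyForm (v ∘ σ)| = 1 := by
    rw [AlternatingMap.map_perm, Units.smul_def, zsmul_eq_mul, abs_mul, h, mul_one]
    exact_mod_cast Int.isUnit_iff_abs_eq.1 (Units.isUnit _)
  have hcross := tripleCross_eq_smul_of_abs_cayleyForm_eq_one (hv.comp σ σ.injective) hσ
  change ⟪w, tripleCross ((v ∘ σ) 1) ((v ∘ σ) 2) ((v ∘ σ) 3)⟫ = 0
  rw [hcross, real_inner_smul_right, Function.comp_apply, hw, mul_zero]

end Orthonormal

theorem abs_cayleyForm_eq_one_iff_tripleCross_mem (e : OrthonormalBasis (Fin 4) ℝ C) :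
    |cayleyForm fun i => (e i : Octonion)| = 1 ↔
      ∀ x ∈ C, ∀ y ∈ C, ∀ z ∈ C, tripleCross x y z ∈ C := by
  have he : Orthonormal ℝ fun i => (e i : Octonion) :=
    e.orthonormal.comp_linearIsometry C.subtypeₗᵢ
  refine ⟨fun h x hx y hy z hz => ?_, fun h => ?_⟩
  · rw [← C.orthogonal_orthogonal, Submodule.mem_orthogonal]
    intro w hw
    have hzero : (cayleyForm.curryLeft w).compLinearMap C.subtype = 0 := by
      refine e.toBasis.ext_alternating fun j hj => ?_
      rw [e.coe_toBasis, AlternatingMap.compLinearMap_apply, AlternatingMap.curryLeft_apply_apply]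
      exact cayleyForm_cons_eq_zero he h
        (fun i => Submodule.inner_left_of_mem_orthogonal (e i).2 hw) hj
    have hxyz := DFunLike.congr_fun hzero ![⟨x, hx⟩, ⟨y, hy⟩, ⟨z, hz⟩]
    rw [AlternatingMap.compLinearMap_apply, AlternatingMap.curryLeft_apply_apply,
      cayleyForm_apply] at hxyz
    exact hxyz
  · set c := tripleCross (e 1) (e 2) (e 3)
    have hc : c ∈ C := h _ (e 1).2 _ (e 2).2 _ (e 3).2
    have hsum : ∑ i, ⟪(e i : Octonion), c⟫ ^ 2 = ‖c‖ ^ 2 := by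
      simpa using e.sum_sq_norm_inner_right ⟨c, hc⟩
    have h₁ : ⟪(e 1 : Octonion), c⟫ = 0 := (inner_tripleCross_self _ _ _).1
    have h₂ : ⟪(e 2 : Octonion), c⟫ = 0 := (inner_tripleCross_self _ _ _).2.1
    have h₃ : ⟪(e 3 : Octonion), c⟫ = 0 := (inner_tripleCross_self _ _ _).2.2
    rw [Fin.sum_univ_four, h₁, h₂, h₃, norm_tripleCross_of_orthonormal he] at hsum
    refine (pow_eq_one_iff_of_nonneg (abs_nonneg _) two_ne_zero).1 ?_
    rw [sq_abs, cayleyForm_apply]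
    simpa using hsum

theorem isHLagrangian_iff_isCalibratedBy :
    IsHLagrangian C ↔ IsCalibratedBy cayleyForm C := by
  suffices key : Module.finrank ℝ C = 4 → (IsHLagrangian C ↔ IsCalibratedBy cayleyForm C) from
    ⟨fun h => (key h.1).1 h, fun h => (key h.2.fst.out).2 h⟩
  intro hC
  let e : OrthonormalBasis (Fin 4) ℝ C := (stdOrthonormalBasis ℝ C).reindex (finCongr hC)
  rw [isHLagrangian_iff_tripleCross_mem, isCalibratedBy_iff_abs_apply_eq_one e,
    abs_cayleyForm_eq_one_iff_tripleCross_mem]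
  exact and_congr_left' (iff_of_true hC isCalibratingForm_cayleyForm)

/-! ### The action of `Spin(7)` -/

variable {φ φ' θ θ' : Octonion ≃ₗᵢ[ℝ] Octonion} {u : Octonion}

/-- `θ` is the twist of `φ`, as in the definition of `Spin(7)`; it is determined by `φ`. -/
def IsTwist (φ θ : Octonion ≃ₗᵢ[ℝ] Octonion) : Prop :=
  ∀ v x : Octonion, φ (v * x) = φ v * θ x

theorem IsTwist.mul (h : IsTwist φ θ) (h' : IsTwist φ' θ') : IsTwist (φ * φ') (θ * θ') :=
  fun v x => by
    simp only [LinearIsometryEquiv.coe_mul, Function.comp_apply]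
    rw [h', h]

theorem IsTwist.map_conj_mul (h : IsTwist φ θ) (x y : Octonion) :
    θ (conj x * y) = conj (φ x) * φ y := by
  rcases eq_or_ne x 0 with rfl | hx
  · have hconj : conj (0 : Octonion) = 0 := by simpa using conj_smul 0 0
    simp only [map_zero, hconj, zero_mul]
  refine smul_right_injective _ (pow_ne_zero 2 (norm_ne_zero_iff.2 hx)) ?_
  calc ‖x‖ ^ 2 • θ (conj x * y)
      = conj (φ x) * (φ x * θ (conj x * y)) := by rw [conj_mul_mul_self, φ.norm_map]
    _ = conj (φ x) * φ (x * (conj x * y)) := by rw [h]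
    _ = ‖x‖ ^ 2 • (conj (φ x) * φ y) := by rw [mul_conj_mul_self, map_smul, mul_smul_comm]

/-- Right multiplication by a unit octonion, as an isometry. -/
noncomputable def rightMul (u : Octonion) (hu : ‖u‖ = 1) : Octonion ≃ₗᵢ[ℝ] Octonion :=
  LinearIsometry.toLinearIsometryEquiv
    ⟨J u, fun x => (norm_mul x u).trans (by rw [hu, mul_one])⟩ rfl

theorem rightMul_apply (hu : ‖u‖ = 1) (x : Octonion) : rightMul u hu x = x * u := rfl

/-- The rotation `x ↦ -ū x ū` for a unit octonion `u`, written as a product of two reflections.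
It is the conjugation `x ↦ ū x u` when `u` is imaginary, and then the twist of right
multiplication by `u`. -/
noncomputable def innerRotation (u : Octonion) : Octonion ≃ₗᵢ[ℝ] Octonion :=
  (ℝ ∙ (1 : Octonion)).reflection * (ℝ ∙ u)ᗮ.reflection

theorem innerRotation_apply (hu : ‖u‖ = 1) (x : Octonion) :
    innerRotation u x = conj x - (2 * ⟪u, x⟫) • conj u := by
  rw [innerRotation, LinearIsometryEquiv.coe_mul, Function.comp_apply,
    reflection_orthogonal_span_singleton_apply hu, map_sub, map_smul, reflection_span_one,
    reflection_span_one]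

theorem innerRotation_of_mem_imaginary (u : Octonion) {x : Octonion}
    (hx : (ℝ ∙ u)ᗮ.reflection x ∈ imaginary) :
    innerRotation u x = -(ℝ ∙ u)ᗮ.reflection x := by
  rw [innerRotation, LinearIsometryEquiv.coe_mul, Function.comp_apply, reflection_span_one,
    conj_of_mem_imaginary hx]

theorem det_innerRotation (hu : u ≠ 0) :
    LinearMap.det ((innerRotation u).toLinearEquiv : Octonion →ₗ[ℝ] Octonion) = 1 := by
  have hone : Module.finrank ℝ (ℝ ∙ (1 : Octonion))ᗮ = 7 := by
    have hone₀ : (1 : Octonion) ≠ 0 := norm_ne_zero_iff.1 (norm_one ▸ one_ne_zero)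
    refine Submodule.finrank_add_finrank_orthogonal' ?_
    rw [finrank_span_singleton hone₀, finrank_eq_eight]
  have hcomp : ((innerRotation u).toLinearEquiv : Octonion →ₗ[ℝ] Octonion) =
      (ℝ ∙ (1 : Octonion)).reflection.toLinearMap ∘ₗ (ℝ ∙ u)ᗮ.reflection.toLinearMap := rfl
  rw [hcomp, LinearMap.det_comp, Submodule.det_reflection, Submodule.det_reflection,
    Submodule.orthogonal_orthogonal, finrank_span_singleton hu, hone]
  norm_num

theorem isTwist_rightMul (hu : ‖u‖ = 1) (hi : u ∈ imaginary) :
    IsTwist (rightMul u hu) (innerRotation u) := fun v x => by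
  have hpolar := mul_mul_conj_add u x v
  have hunit := mul_mul_conj_self u v
  rw [conj_of_mem_imaginary hi, mul_neg] at hpolar hunit
  rw [hu, one_pow, one_smul] at hunit
  rw [rightMul_apply, rightMul_apply, innerRotation_apply hu, conj_of_mem_imaginary hi, mul_sub,
    mul_smul_comm, mul_neg, hunit, ← hpolar]
  abel

theorem rightMul_mem_spin7 (hu : ‖u‖ = 1) (hi : u ∈ imaginary) : rightMul u hu ∈ spin7 :=
  ⟨innerRotation u, det_innerRotation (norm_ne_zero_iff.1 (hu ▸ one_ne_zero)),
    isTwist_rightMul hu hi⟩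

/-- Up to a scalar (necessarily a sign), the isometry `ψ` of `Im 𝕆` is the restriction of the
twist of an element of `Spin(7)`. -/
def LiftsToSpin7 (ψ : imaginary ≃ₗᵢ[ℝ] imaginary) : Prop :=
  ∃ φ ∈ spin7, ∃ θ, IsTwist φ θ ∧ ∃ ε : ℝ, ∀ x : imaginary, θ x = ε • (ψ x : Octonion)

theorem liftsToSpin7_one : LiftsToSpin7 1 :=
  ⟨1, one_mem _, 1, fun _ _ => rfl, 1, fun _ => (one_smul ℝ _).symm⟩

theorem LiftsToSpin7.mul {ψ ψ' : imaginary ≃ₗᵢ[ℝ] imaginary} (h : LiftsToSpin7 ψ)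
    (h' : LiftsToSpin7 ψ') : LiftsToSpin7 (ψ * ψ') := by
  obtain ⟨φ, hφ, θ, hθ, ε, hε⟩ := h
  obtain ⟨φ', hφ', θ', hθ', ε', hε'⟩ := h'
  refine ⟨φ * φ', mul_mem hφ hφ', θ * θ', hθ.mul hθ', ε' * ε, fun x => ?_⟩
  rw [LinearIsometryEquiv.coe_mul, Function.comp_apply, hε', map_smul, hε, smul_smul]
  rfl

theorem liftsToSpin7_reflection_of_norm_eq_one {v : imaginary} (hv : ‖v‖ = 1) :
    LiftsToSpin7 (ℝ ∙ v)ᗮ.reflection := by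
  refine ⟨rightMul v hv, rightMul_mem_spin7 hv v.2, innerRotation v, isTwist_rightMul hv v.2, -1,
    fun x => ?_⟩
  rw [neg_one_smul, coe_reflection_orthogonal_span_singleton, innerRotation_of_mem_imaginary]
  rw [← coe_reflection_orthogonal_span_singleton]
  exact Subtype.mem _

theorem liftsToSpin7_reflection (v : imaginary) : LiftsToSpin7 (ℝ ∙ v)ᗮ.reflection := by
  rcases eq_or_ne v 0 with rfl | hv
  · have hone : (ℝ ∙ (0 : imaginary))ᗮ.reflection = 1 := LinearIsometryEquiv.ext fun x => by
      rw [Submodule.reflection_orthogonal_apply, Submodule.reflection_singleton_apply]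
      simp
    rw [hone]
    exact liftsToSpin7_one
  · have hunit : ‖‖v‖⁻¹ • v‖ = 1 := norm_smul_inv_norm hv
    have hlift := liftsToSpin7_reflection_of_norm_eq_one hunit
    simpa only [Submodule.span_singleton_smul_eq (inv_ne_zero (norm_ne_zero_iff.2 hv)).isUnit]
      using hlift

theorem liftsToSpin7 (ψ : imaginary ≃ₗᵢ[ℝ] imaginary) : LiftsToSpin7 ψ := by
  obtain ⟨l, -, rfl⟩ := ψ.reflections_generate_dim
  induction l with
  | nil => exact liftsToSpin7_one
  | cons v l ih => exact (liftsToSpin7_reflection v).mul ih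

theorem exists_isTwist_map_eq (hM : 1 ∈ M) (hN : 1 ∈ N)
    (hMN : Module.finrank ℝ M = Module.finrank ℝ N) :
    ∃ φ ∈ spin7, ∃ θ, IsTwist φ θ ∧
      M.map (θ.toLinearEquiv : Octonion →ₗ[ℝ] Octonion) = N := by
  have hfinrank : Module.finrank ℝ Mᗮ = Module.finrank ℝ Nᗮ := by
    have h₁ := M.finrank_add_finrank_orthogonal
    have h₂ := N.finrank_add_finrank_orthogonal
    omega
  have hcomap {K : Submodule ℝ Octonion} (hK : 1 ∈ K) :
      Module.finrank ℝ (Kᗮ.comap imaginary.subtype) = Module.finrank ℝ Kᗮ :=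
    (Submodule.comapSubtypeEquivOfLe (orthogonal_le_imaginary hK)).finrank_eq
  obtain ⟨ψ, hψ⟩ := exists_linearIsometryEquiv_map_eq
    ((hcomap hM).trans (hfinrank.trans (hcomap hN).symm))
  obtain ⟨φ, hφ, θ, hφθ, ε, hθ⟩ := liftsToSpin7 ψ
  have hmap : Mᗮ.map (θ.toLinearEquiv : Octonion →ₗ[ℝ] Octonion) = Nᗮ := by
    refine Submodule.eq_of_le_of_finrank_eq ?_
      ((θ.toLinearEquiv.finrank_map_eq _).trans hfinrank)
    rintro _ ⟨x, hx, rfl⟩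
    let x' : imaginary := ⟨x, orthogonal_le_imaginary hM hx⟩
    have hx' : ψ x' ∈ Nᗮ.comap imaginary.subtype := hψ ▸ Submodule.mem_map_of_mem hx
    exact (hθ x').symm ▸ Nᗮ.smul_mem ε hx'
  refine ⟨φ, hφ, θ, hφθ, ?_⟩
  rw [Submodule.map_orthogonal_equiv] at hmap
  simpa only [Submodule.orthogonal_orthogonal] using congrArg Submodule.orthogonal hmap

theorem mem_quaternions {x : Octonion} : x ∈ quaternions ↔ x.snd = 0 := Iff.rfl

theorem finrank_quaternions : Module.finrank ℝ quaternions = 4 := by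
  let e : ℍ[ℝ] ≃ₗ[ℝ] quaternions :=
    { toFun q := ⟨WithLp.toLp 2 (q, 0), rfl⟩
      invFun x := x.1.fst
      map_add' _ _ := Subtype.ext (Octonion.ext (by simp) (by simp))
      map_smul' _ _ := Subtype.ext (Octonion.ext (by simp) (by simp))
      left_inv _ := rfl
      right_inv x := Subtype.ext (Octonion.ext rfl (mem_quaternions.1 x.2).symm) }
  rw [← e.finrank_eq, Quaternion.finrank_eq_four]

theorem mem_quaternions_orthogonal {x : Octonion} : x ∈ quaternionsᗮ ↔ x.fst = 0 := by
  rw [Submodule.mem_orthogonal]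
  refine ⟨fun h => ?_, fun h y hy => ?_⟩
  · have hfst := h (WithLp.toLp 2 (x.fst, 0)) rfl
    rw [WithLp.prod_inner_apply] at hfst
    simpa using hfst
  · rw [inner_eq, h, mem_quaternions.1 hy]
    simp

theorem one_mem_quaternions : 1 ∈ quaternions := one_snd

theorem conj_mul_mem_quaternions {x y : Octonion} (hx : x ∈ quaternions)
    (hy : y ∈ quaternions) : conj x * y ∈ quaternions := by
  rw [mem_quaternions] at hx hy ⊢
  simp only [mul_snd, conj_snd, hx, hy, neg_zero, mul_zero, add_zero]

theorem conj_mul_mem_quaternions_iff {x y : Octonion} :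
    conj x * y ∈ quaternions ↔ x.fst * y.snd = y.fst * x.snd := by
  rw [mem_quaternions, mul_snd, conj_fst, conj_snd, star_star, mul_neg, ← sub_eq_add_neg,
    sub_eq_zero]

theorem fst_eq_zero_or_snd_eq_zero (hC : Module.finrank ℝ C = 4)
    (h : ∀ x ∈ C, ∀ y ∈ C, conj x * y ∈ quaternions) {x : Octonion} (hx : x ∈ C) :
    x.fst = 0 ∨ x.snd = 0 := by
  have hmul (q : ℍ[ℝ]) : WithLp.toLp 2 (x.fst * q, q * x.snd) ∈ C := by
    convert mul_mem_of_conj_mul_mem (finrank_quaternions.trans hC.symm).le h hx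
      (m := WithLp.toLp 2 (q, 0)) rfl using 1
    ext1 <;> simp [mul_fst, mul_snd]
  have hcomm (p q : ℍ[ℝ]) : x.fst * (p * q - q * p) * x.snd = 0 := by
    have hpq := conj_mul_mem_quaternions_iff.1 (h _ (hmul p) _ (hmul q))
    rw [mul_sub, sub_mul, sub_eq_zero]
    simpa only [WithLp.toLp_fst, WithLp.toLp_snd, mul_assoc] using hpq
  obtain ⟨p, q, hpq⟩ : ∃ p q : ℍ[ℝ], p * q - q * p ≠ 0 := by
    let i : ℍ[ℝ] := ⟨0, 1, 0, 0⟩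
    let j : ℍ[ℝ] := ⟨0, 0, 1, 0⟩
    refine ⟨i, j, fun hij => ?_⟩
    have hk := congrArg QuaternionAlgebra.imK hij
    rw [Quaternion.imK_sub, Quaternion.imK_mul, Quaternion.imK_mul] at hk
    norm_num [i, j] at hk
  simpa only [mul_eq_zero, hpq, or_false] using hcomm p q

theorem eq_quaternions_or_eq_orthogonal (hC : Module.finrank ℝ C = 4)
    (h : ∀ x ∈ C, ∀ y ∈ C, conj x * y ∈ quaternions) :
    C = quaternions ∨ C = quaternionsᗮ := by
  obtain ⟨x, hx, hx₀⟩ := exists_mem_ne_zero_of_finrank_ne_zero (hC ▸ four_ne_zero)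
  have hxy {y : Octonion} (hy : y ∈ C) := conj_mul_mem_quaternions_iff.1 (h x hx y hy)
  rcases fst_eq_zero_or_snd_eq_zero hC h hx with hfst | hsnd
  · have hsnd : x.snd ≠ 0 := fun hsnd => hx₀ (Octonion.ext hfst hsnd)
    refine .inr (Submodule.eq_of_le_of_finrank_eq (fun y hy => ?_)
      (hC.trans (finrank_orthogonal_eq_four finrank_quaternions).symm))
    simpa [hfst, hsnd, mem_quaternions_orthogonal] using hxy hy
  · have hfst : x.fst ≠ 0 := fun hfst => hx₀ (Octonion.ext hfst hsnd)
    refine .inl (Submodule.eq_of_le_of_finrank_eq (fun y hy => ?_)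
      (hC.trans finrank_quaternions.symm))
    simpa [hfst, hsnd, mem_quaternions] using hxy hy

theorem isSpin7Translate_quaternions : IsSpin7Translate quaternions :=
  ⟨1, one_mem _, (Submodule.map_id _).symm⟩

theorem IsSpin7Translate.of_map (hφ : φ ∈ spin7)
    (h : IsSpin7Translate (C.map (φ.toLinearEquiv : Octonion →ₗ[ℝ] Octonion))) :
    IsSpin7Translate C := by
  obtain ⟨χ, hχ, h⟩ := h
  refine ⟨φ⁻¹ * χ, mul_mem (inv_mem hφ) hχ, ?_⟩
  refine Submodule.map_injective_of_injective φ.toLinearEquiv.injective (h.trans ?_)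
  rw [← Submodule.map_comp]
  congr 1
  ext1 x
  exact (φ.apply_symm_apply (χ x)).symm

theorem isSpin7Translate_quaternions_orthogonal : IsSpin7Translate quaternionsᗮ := by
  let u : Octonion := WithLp.toLp 2 (0, 1)
  have hu : ‖u‖ = 1 := by
    rw [norm_eq_sqrt_real_inner, inner_eq]
    simp [u]
  refine ⟨rightMul u hu, rightMul_mem_spin7 hu rfl, Eq.symm ?_⟩
  refine Submodule.eq_of_le_of_finrank_eq ?_ ?_
  · rintro _ ⟨x, hx, rfl⟩
    change x * u ∈ _
    simp [mem_quaternions_orthogonal, mul_fst, mem_quaternions.1 hx, u]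
  · rw [(rightMul u hu).toLinearEquiv.finrank_map_eq, finrank_quaternions,
      finrank_orthogonal_eq_four finrank_quaternions]

theorem IsSpin7Translate.isHLagrangian (h : IsSpin7Translate C) : IsHLagrangian C := by
  obtain ⟨φ, ⟨θ, -, hφθ⟩, rfl⟩ := h
  refine isHLagrangian_iff_exists_conj_mul_mem.2
    ⟨(φ.toLinearEquiv.finrank_map_eq _).trans finrank_quaternions,
      quaternions.map (θ.toLinearEquiv : Octonion →ₗ[ℝ] Octonion),
      (θ.toLinearEquiv.finrank_map_eq _).trans finrank_quaternions, ?_⟩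
  rintro _ ⟨x, hx, rfl⟩ _ ⟨y, hy, rfl⟩
  exact ⟨conj x * y, conj_mul_mem_quaternions hx hy, IsTwist.map_conj_mul hφθ x y⟩

theorem IsHLagrangian.isSpin7Translate (h : IsHLagrangian C) : IsSpin7Translate C := by
  obtain ⟨hC, M, hM, hCM⟩ := isHLagrangian_iff_exists_conj_mul_mem.1 h
  obtain ⟨x, hx, hx₀⟩ := exists_mem_ne_zero_of_finrank_ne_zero (hC ▸ four_ne_zero)
  obtain ⟨φ, hφ, θ, hφθ, hMθ⟩ := exists_isTwist_map_eq
    (one_mem_of_conj_mul_mem hx₀ (hCM x hx x hx)) one_mem_quaternions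
    (hM.trans finrank_quaternions.symm)
  refine .of_map hφ ?_
  have hφC : ∀ x ∈ C.map (φ.toLinearEquiv : Octonion →ₗ[ℝ] Octonion),
      ∀ y ∈ C.map (φ.toLinearEquiv : Octonion →ₗ[ℝ] Octonion), conj x * y ∈ quaternions := by
    rintro _ ⟨x, hx, rfl⟩ _ ⟨y, hy, rfl⟩
    rw [← hMθ]
    exact ⟨conj x * y, hCM x hx y hy, hφθ.map_conj_mul x y⟩
  rcases eq_quaternions_or_eq_orthogonal
    ((φ.toLinearEquiv.finrank_map_eq C).trans hC) hφC with h | h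
  · rw [h]
    exact isSpin7Translate_quaternions
  · rw [h]
    exact isSpin7Translate_quaternions_orthogonal

theorem isHLagrangian_iff_isSpin7Translate : IsHLagrangian C ↔ IsSpin7Translate C :=
  ⟨IsHLagrangian.isSpin7Translate, IsSpin7Translate.isHLagrangian⟩

end Octonion

theorem mainTheorem5 (C : Submodule ℝ Octonion) (hC : Module.finrank ℝ C = 4) :
    (Octonion.IsHLagrangian C ↔ Octonion.IsSpin7Translate C) ∧
      (Octonion.IsHLagrangian C ↔ IsCalibratedBy Octonion.cayleyForm C) :=
  ⟨Octonion.isHLagrangian_iff_isSpin7Translate, Octonion.isHLagrangian_iff_isCalibratedBy⟩
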